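/- An o-minimal structure on the real field is a sequence $\mathcal D=(\mathcal D_n)_{n\in\mathbb N}$, $\mathcal D_n$ a collection of subsets of $\mathbb R^n$, such that for every $n$: $\mathcal D_n$ is closed under complements and finite unions; $A\in\mathcal D_n$ implies $A\times\mathbb R,\ \mathbb R\times A\in\mathcal D_{n+1}$; the projection to the first $n$ coordinates of any $A\in\mathcal D_{n+1}$ is in $\mathcal D_n$; $\mathcal D_n$ contains the zero set of every polynomial in $\mathbb R[X_1,\dots,X_n]$; and every set in $\mathcal D_1$ is a finite union of intervals and points. A map $F:A\to\mathbb R^n$, $A\subseteq\mathbb R^m$, is definable (in $\mathcal D$) if its graph $\{(x,F(x)) : x\in A\}$ belongs to $\mathcal D_{m+n}$. Let $d\ge 1$, let $f:\mathbb R^d\to\mathbb R$ be a $C^1$ function and let $c\in\mathbb R^d$. The tangency set of $f$ relative to $c$ is $$\Pi_c(f)=\{x\in\mathbb R^d : x\ne c,\ \nabla f(x)=\lambda(x-c)\text{ for some }\lambda\in\mathbb R\}.$$ For $\varepsilon>0$, a tangency arc on $[0,\varepsilon)$ relative to $c$ is a continuous curve $\gamma:[0,\varepsilon)\to\mathbb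 R^d$ with $\gamma(0)=c$ and $\gamma(t)\in\Pi_c(f)$ for $t\in(0,\varepsilon)$; it is said to be parameterized by arc length if $\|\gamma(t)-c\|=t$ (Euclidean norm) for all $t\in[0,\varepsilon)$. For $r\ge 0$ let $m(r)$ and $M(r)$ be the minimum and the maximum of $f$ on the sphere $\{x\in\mathbb R^d:\|x-c\|=r\}$. **Corollary.** If $f$ is definable in an o-minimal structure $\mathcal D$, then there are $\varepsilon>0$ and a tangency arc $\gamma:[0,\varepsilon)\to\mathbb R^d$ relative to $c$, definable in $\mathcal D$ and parameterized by arc length, such that $f(\gamma(r))=m(r)$ for all $r\in[0,\varepsilon)$. Likewise, there are $\varepsilon>0$ and a tangency arc $\gamma:[0,\varepsilon)\to\mathbb R^d$ relative to $c$, definable in $\mathcal D$ and parameterized by arc length, such that $f(\gamma(r))=M(r)$ for all $r\in[0,\varepsilon)$. -/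

import Mathlib

/-- An o-minimal structure on the real field `(ℝ, +, ·)`: for every `n` a family `Def n` of subsets
of `ℝⁿ` (the definable sets). Here `Fin.init` forgets the last coordinate and `Fin.tail` the
first one. -/
structure OMinimalStructure where
  /-- The definable subsets of `ℝⁿ`. -/
  Def : (n : ℕ) → Set (Set (Fin n → ℝ))
  /-- Closure under complements. -/
  compl_mem : ∀ {n : ℕ} {A : Set (Fin n → ℝ)}, A ∈ Def n → Aᶜ ∈ Def n
  /-- Closure under finite unions. -/
  union_mem : ∀ {n : ℕ} {A B : Set (Fin n → ℝ)}, A ∈ Def n → B ∈ Def n → A ∪ B ∈ Def n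
  /-- Closure under `A ↦ A × ℝ`. -/
  prod_line_mem : ∀ {n : ℕ} {A : Set (Fin n → ℝ)}, A ∈ Def n →
    {x : Fin (n + 1) → ℝ | Fin.init x ∈ A} ∈ Def (n + 1)
  /-- Closure under `A ↦ ℝ × A`. -/
  line_prod_mem : ∀ {n : ℕ} {A : Set (Fin n → ℝ)}, A ∈ Def n →
    {x : Fin (n + 1) → ℝ | Fin.tail x ∈ A} ∈ Def (n + 1)
  /-- Closure under the projection onto the first `n` coordinates. -/
  proj_mem : ∀ {n : ℕ} {A : Set (Fin (n + 1) → ℝ)}, A ∈ Def (n + 1) →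
    {x : Fin n → ℝ | ∃ y ∈ A, Fin.init y = x} ∈ Def n
  /-- Zero sets of real polynomials are definable. -/
  zeros_mem : ∀ {n : ℕ} (P : MvPolynomial (Fin n) ℝ),
    {x : Fin n → ℝ | MvPolynomial.eval x P = 0} ∈ Def n
  /-- O-minimality: a definable subset of `ℝ` is a finite union of intervals and points. The
  order-connected subsets of `ℝ` are exactly the intervals of any kind, bounded or not,
  including the one-point sets and the empty set. -/
  o_minimal : ∀ {A : Set (Fin 1 → ℝ)}, A ∈ Def 1 →
    ∃ I : Set (Set ℝ), I.Finite ∧ (∀ J ∈ I, J.OrdConnected) ∧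
      {t : ℝ | (fun _ : Fin 1 => t) ∈ A} = ⋃₀ I

namespace OMinimalStructure

/-- A map `F : A → ℝⁿ`, `A ⊆ ℝᵐ`, is definable if its graph `{(x, F x) | x ∈ A}` is a definable
subset of `ℝᵐ⁺ⁿ`. -/
def DefinableMapOn (D : OMinimalStructure) {m n : ℕ} (A : Set (Fin m → ℝ))
    (F : (Fin m → ℝ) → (Fin n → ℝ)) : Prop :=
  {z : Fin (m + n) → ℝ | ∃ x ∈ A, z = Fin.append x (F x)} ∈ D.Def (m + n)

/-- Definability of a function `f : ℝᵈ → ℝ`. -/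
def DefinableFun (D : OMinimalStructure) {d : ℕ} (f : EuclideanSpace ℝ (Fin d) → ℝ) : Prop :=
  D.DefinableMapOn Set.univ (fun (x : Fin d → ℝ) (_ : Fin 1) => f (WithLp.toLp 2 x))

/-- Definability of a curve `γ : [0, ε) → ℝᵈ`. -/
def DefinableCurve (D : OMinimalStructure) {d : ℕ} (ε : ℝ)
    (γ : ℝ → EuclideanSpace ℝ (Fin d)) : Prop :=
  D.DefinableMapOn {t : Fin 1 → ℝ | t 0 ∈ Set.Ico 0 ε}
    (fun (t : Fin 1 → ℝ) (i : Fin d) => γ (t 0) i)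

end OMinimalStructure

section Tangency

variable {d : ℕ}

/-- The tangency set of `f` relative to `c`: all points `x ≠ c` with `∇ f(x) = μ (x - c)` for
some real `μ`. -/
def tangencySet (f : EuclideanSpace ℝ (Fin d) → ℝ) (c : EuclideanSpace ℝ (Fin d)) :
    Set (EuclideanSpace ℝ (Fin d)) :=
  {x | x ≠ c ∧ ∃ μ : ℝ, gradient f x = μ • (x - c)}

/-- A tangency arc of `f` relative to `c` with domain `[0, ε)`: a continuous curve on `[0, ε)`
starting at `c` and lying in the tangency set on `(0, ε)`. Only the values of `γ` on `[0, ε)`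
matter. -/
structure IsTangencyArc (f : EuclideanSpace ℝ (Fin d) → ℝ) (c : EuclideanSpace ℝ (Fin d))
    (ε : ℝ) (γ : ℝ → EuclideanSpace ℝ (Fin d)) : Prop where
  continuousOn : ContinuousOn γ (Set.Ico 0 ε)
  start : γ 0 = c
  mem_tangencySet : ∀ t ∈ Set.Ioo 0 ε, γ t ∈ tangencySet f c

/-- The curve `γ` on `[0, ε)` is parameterized by arc length relative to `c`, in the sense that
its point at time `t` has distance `t` from `c`. -/
def IsArcLengthParam (c : EuclideanSpace ℝ (Fin d)) (ε : ℝ)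
    (γ : ℝ → EuclideanSpace ℝ (Fin d)) : Prop :=
  ∀ t ∈ Set.Ico 0 ε, ‖γ t - c‖ = t

/-- `m(r)`, the minimum of `f` on the sphere of radius `r` about `c`. -/
noncomputable def sphereMin (f : EuclideanSpace ℝ (Fin d) → ℝ) (c : EuclideanSpace ℝ (Fin d))
    (r : ℝ) : ℝ :=
  sInf (f '' Metric.sphere c r)

/-- `M(r)`, the maximum of `f` on the sphere of radius `r` about `c`. -/
noncomputable def sphereMax (f : EuclideanSpace ℝ (Fin d) → ℝ) (c : EuclideanSpace ℝ (Fin d))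
    (r : ℝ) : ℝ :=
  sSup (f '' Metric.sphere c r)

/-- For continuous `f` on `ℝᵈ`, `d ≥ 1`, the minimum `m(r)` is attained. -/
theorem isLeast_sphereMin (hd : 1 ≤ d) {f : EuclideanSpace ℝ (Fin d) → ℝ} (hf : Continuous f)
    (c : EuclideanSpace ℝ (Fin d)) {r : ℝ} (hr : 0 ≤ r) :
    IsLeast (f '' Metric.sphere c r) (sphereMin f c r) := by
  have : Nonempty (Fin d) := ⟨⟨0, hd⟩⟩
  exact ((isCompact_sphere c r).image hf).isLeast_sInf
    ((NormedSpace.sphere_nonempty.2 hr).image f)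

/-- For continuous `f` on `ℝᵈ`, `d ≥ 1`, the maximum `M(r)` is attained. -/
theorem isGreatest_sphereMax (hd : 1 ≤ d) {f : EuclideanSpace ℝ (Fin d) → ℝ}
    (hf : Continuous f) (c : EuclideanSpace ℝ (Fin d)) {r : ℝ} (hr : 0 ≤ r) :
    IsGreatest (f '' Metric.sphere c r) (sphereMax f c r) := by
  have : Nonempty (Fin d) := ⟨⟨0, hd⟩⟩
  exact ((isCompact_sphere c r).image hf).isGreatest_sSup
    ((NormedSpace.sphere_nonempty.2 hr).image f)

end Tangency

/-! On each sphere about `c` the minimizers of `f` form a nonempty compact set, and by Lagrange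
multipliers a minimizer other than `c` is a tangency point. It remains to choose one minimizer `g r`
on each sphere, definably in `r` and continuously near `0`.

Definability: the minimizers form a definable family, being described by a first-order formula, and
the lexicographically least point of each compact fibre is unique and again described by a formula
(`exists_definable_selection`).

Continuity: the monotonicity theorem is not needed. A definable curve takes values in countably many
small cubes, and the set of times spent in each is a finite union of intervals; hence every open set
contains an interval on which the curve oscillates little. By Baire, `g` is continuous on a dense
set. That set is itself definable, so it is a finite union of intervals, and being dense it contains
some `(0, ε)` (`exists_continuousAt`). At `0`, continuity follows from `‖g r - c‖ = r`.

The maximum is the minimum for `-f`. -/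

namespace OMinimalStructure

/-! ### Closure properties of definable sets -/

variable (D : OMinimalStructure)

theorem univ_mem (n : ℕ) : Set.univ ∈ D.Def n := by
  simpa using D.zeros_mem (0 : MvPolynomial (Fin n) ℝ)

theorem inter_mem {n : ℕ} {A B : Set (Fin n → ℝ)} (hA : A ∈ D.Def n) (hB : B ∈ D.Def n) :
    A ∩ B ∈ D.Def n := by
  have := D.compl_mem (D.union_mem (D.compl_mem hA) (D.compl_mem hB))
  rwa [Set.compl_union, compl_compl, compl_compl] at this

theorem forall_mem {n : ℕ} {ι : Type*} [Finite ι] {A : ι → Set (Fin n → ℝ)}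
    (hA : ∀ i, A i ∈ D.Def n) : {x | ∀ i, x ∈ A i} ∈ D.Def n := by
  have key : ∀ s : Set ι, s.Finite → {x | ∀ i ∈ s, x ∈ A i} ∈ D.Def n := by
    intro s hs
    induction s, hs using Set.Finite.induction_on with
    | empty => simpa using D.univ_mem n
    | @insert a s _ _ ih =>
      have := D.inter_mem (hA a) ih
      convert this using 1
      ext x
      simp
  simpa using key Set.univ Set.finite_univ

/-- Closure under `A ↦ ℝⁿ × A`. -/
theorem natAdd_mem {m : ℕ} {A : Set (Fin m → ℝ)} (hA : A ∈ D.Def m) :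
    ∀ (n N : ℕ) (h : n + m = N),
      {x : Fin N → ℝ | (fun i => x (Fin.cast h (Fin.natAdd n i))) ∈ A} ∈ D.Def N := by
  intro n
  induction n with
  | zero =>
    intro N h
    obtain rfl : m = N := by omega
    convert hA using 1
    ext x
    have : ∀ i, Fin.cast h (Fin.natAdd 0 i) = i := fun i => Fin.ext (by simp)
    simp only [Set.mem_ofPred_eq, this]
  | succ n ih =>
    intro N h
    obtain rfl : (n + m) + 1 = N := by omega
    convert D.line_prod_mem (ih (n + m) rfl) using 1
    ext x
    have : ∀ i : Fin m, Fin.cast h (Fin.natAdd (n + 1) i) = (Fin.natAdd n i).succ :=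
      fun i => Fin.ext (by simp; omega)
    simp only [Set.mem_ofPred_eq, Fin.tail, this, Fin.cast_eq_self]

/-- Closure under projection to the first `n` coordinates. -/
theorem exists_append_mem {n : ℕ} : ∀ {m : ℕ} {A : Set (Fin (n + m) → ℝ)}, A ∈ D.Def (n + m) →
    {x : Fin n → ℝ | ∃ y : Fin m → ℝ, Fin.append x y ∈ A} ∈ D.Def n := by
  intro m
  induction m with
  | zero =>
    intro A hA
    refine Set.mem_of_eq_of_mem (y := (A : Set (Fin n → ℝ))) (Set.ext fun x => ?_) hA
    constructor
    · rintro ⟨y, hy⟩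
      rw [Subsingleton.elim y Fin.elim0, Fin.append_elim0] at hy
      exact hy
    · intro hx
      refine ⟨Fin.elim0, ?_⟩
      rw [Fin.append_elim0]
      exact hx
  | succ m ih =>
    intro A hA
    have h := ih (D.proj_mem (n := n + m) hA)
    convert h using 1
    ext x
    constructor
    · rintro ⟨y, hy⟩
      refine ⟨Fin.init y, _, hy, ?_⟩
      conv_lhs => rw [← Fin.snoc_init_self y, Fin.append_snoc]
      exact Fin.init_snoc _ _
    · rintro ⟨y, z, hz, hzy⟩
      refine ⟨Fin.snoc y (z (Fin.last _)), ?_⟩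
      rw [Fin.append_snoc, ← hzy]
      exact Set.mem_of_eq_of_mem (Fin.snoc_init_self z) hz

/-- Closure under preimages by maps that permute, repeat or forget coordinates. -/
theorem reindex_mem {m n : ℕ} {A : Set (Fin m → ℝ)} (hA : A ∈ D.Def m) (σ : Fin m → Fin n) :
    {x : Fin n → ℝ | (fun i => x (σ i)) ∈ A} ∈ D.Def n := by
  have h1 := D.natAdd_mem hA n (n + m) rfl
  -- The preimage is the projection to `x` of the pairs `(x, y)` with `y ∈ A` and `y i = x (σ i)`;
  -- the equations are polynomial.
  have h2 : {z : Fin (n + m) → ℝ |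
      ∀ i : Fin m, z (Fin.natAdd n i) = z (Fin.castAdd m (σ i))} ∈ D.Def (n + m) := by
    refine D.forall_mem (A := fun i => {z | z (Fin.natAdd n i) = z (Fin.castAdd m (σ i))})
      fun i => ?_
    convert D.zeros_mem (MvPolynomial.X (Fin.natAdd n i) - MvPolynomial.X (Fin.castAdd m (σ i)))
      using 1
    ext z
    simp [sub_eq_zero]
  convert D.exists_append_mem (D.inter_mem h1 h2) using 1
  ext x
  simp only [Set.mem_ofPred_eq, Set.mem_inter_iff, Fin.cast_eq_self, Fin.append_left,
    Fin.append_right]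
  constructor
  · intro h
    exact ⟨_, h, fun i => rfl⟩
  · rintro ⟨y, hy, h⟩
    obtain rfl : y = fun i => x (σ i) := funext h
    exact hy

/-- A predicate on `ι → ℝ` is definable if it depends on finitely many coordinates, which it
constrains to lie in a definable set. -/
def DefinablePred {ι : Type*} (p : (ι → ℝ) → Prop) : Prop :=
  ∃ (n : ℕ) (σ : Fin n → ι), ∃ A ∈ D.Def n, ∀ x, p x ↔ (fun i => x (σ i)) ∈ A

/-- A function of the form `x ↦ P x` with a real polynomial `P`. -/
def IsPolynomialFun {ι : Type*} (u : (ι → ℝ) → ℝ) : Prop :=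
  ∃ P : MvPolynomial ι ℝ, ∀ x, u x = MvPolynomial.eval x P

namespace IsPolynomialFun

variable {ι : Type*} {u v : (ι → ℝ) → ℝ}

theorem coord (i : ι) : IsPolynomialFun fun x : ι → ℝ => x i :=
  ⟨MvPolynomial.X i, fun x => by simp⟩

theorem const (a : ℝ) : IsPolynomialFun fun _ : ι → ℝ => a :=
  ⟨MvPolynomial.C a, fun x => by simp⟩

theorem add (hu : IsPolynomialFun u) (hv : IsPolynomialFun v) :
    IsPolynomialFun fun x => u x + v x := by
  obtain ⟨P, hP⟩ := hu
  obtain ⟨Q, hQ⟩ := hv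
  exact ⟨P + Q, fun x => by simp [hP, hQ]⟩

theorem sub (hu : IsPolynomialFun u) (hv : IsPolynomialFun v) :
    IsPolynomialFun fun x => u x - v x := by
  obtain ⟨P, hP⟩ := hu
  obtain ⟨Q, hQ⟩ := hv
  exact ⟨P - Q, fun x => by simp [hP, hQ]⟩

theorem pow (hu : IsPolynomialFun u) (k : ℕ) : IsPolynomialFun fun x => u x ^ k := by
  obtain ⟨P, hP⟩ := hu
  exact ⟨P ^ k, fun x => by simp [hP]⟩

theorem sum {κ : Type*} {s : Finset κ} {w : κ → (ι → ℝ) → ℝ}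
    (hw : ∀ k, IsPolynomialFun (w k)) : IsPolynomialFun fun x => ∑ k ∈ s, w k x := by
  choose P hP using hw
  exact ⟨∑ k ∈ s, P k, fun x => by simp [hP]⟩

end IsPolynomialFun

/-! ### First-order formulas define definable sets -/

namespace DefinablePred

variable {D} {ι κ : Type*} {p q : (ι → ℝ) → Prop} {u v : (ι → ℝ) → ℝ}

theorem comp {p : (κ → ℝ) → Prop} (hp : D.DefinablePred p) (σ : κ → ι) :
    D.DefinablePred fun x : ι → ℝ => p fun k => x (σ k) := by
  obtain ⟨n, τ, A, hA, h⟩ := hp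
  exact ⟨n, fun i => σ (τ i), A, hA, fun x => h _⟩

theorem congr (hp : D.DefinablePred p) (h : ∀ x, q x ↔ p x) : D.DefinablePred q := by
  rwa [show q = p from funext fun x => propext (h x)]

theorem setOf_mem {n : ℕ} {p : (Fin n → ℝ) → Prop} (hp : D.DefinablePred p) :
    {x | p x} ∈ D.Def n := by
  obtain ⟨m, σ, A, hA, h⟩ := hp
  simpa only [h] using D.reindex_mem hA σ

theorem of_mem {n : ℕ} {A : Set (Fin n → ℝ)} (hA : A ∈ D.Def n) :
    D.DefinablePred fun x => x ∈ A :=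
  ⟨n, id, A, hA, fun _ => Iff.rfl⟩

theorem not (hp : D.DefinablePred p) : D.DefinablePred fun x => ¬ p x := by
  obtain ⟨n, σ, A, hA, h⟩ := hp
  exact ⟨n, σ, Aᶜ, D.compl_mem hA, fun x => not_congr (h x)⟩

theorem and (hp : D.DefinablePred p) (hq : D.DefinablePred q) :
    D.DefinablePred fun x => p x ∧ q x := by
  obtain ⟨n, σ, A, hA, hp⟩ := hp
  obtain ⟨m, τ, B, hB, hq⟩ := hq
  refine ⟨n + m, Fin.append σ τ, _,
    D.inter_mem (D.reindex_mem hA (Fin.castAdd m)) (D.reindex_mem hB (Fin.natAdd n)), fun x => ?_⟩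
  simp [hp, hq]

theorem or (hp : D.DefinablePred p) (hq : D.DefinablePred q) :
    D.DefinablePred fun x => p x ∨ q x :=
  (hp.not.and hq.not).not.congr fun x => by tauto

theorem imp (hp : D.DefinablePred p) (hq : D.DefinablePred q) :
    D.DefinablePred fun x => p x → q x :=
  (hp.and hq.not).not.congr fun x => by tauto

theorem of_isEmpty [IsEmpty ι] (a : Prop) : D.DefinablePred fun _ : ι → ℝ => a := by
  by_cases ha : a
  · exact ⟨0, Fin.elim0, _, D.univ_mem 0, fun x => by simp [ha]⟩
  · exact ⟨0, Fin.elim0, _, D.compl_mem (D.univ_mem 0), fun x => by simp [ha]⟩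

theorem const (a : Prop) : D.DefinablePred fun _ : ι → ℝ => a :=
  (of_isEmpty (ι := Empty) a).comp Empty.elim

theorem forall_finite [Finite κ] {p : κ → (ι → ℝ) → Prop} (hp : ∀ k, D.DefinablePred (p k)) :
    D.DefinablePred fun x => ∀ k, p k x := by
  have key : ∀ s : Set κ, s.Finite → D.DefinablePred fun x => ∀ k ∈ s, p k x := by
    intro s hs
    induction s, hs using Set.Finite.induction_on with
    | empty => exact (const True).congr fun _ => by simp
    | @insert a s _ _ ih => exact ((hp a).and ih).congr fun x => by simp
  exact (key Set.univ Set.finite_univ).congr fun x => by simp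

theorem exists_finite [Finite κ] {p : κ → (ι → ℝ) → Prop} (hp : ∀ k, D.DefinablePred (p k)) :
    D.DefinablePred fun x => ∃ k, p k x :=
  (forall_finite fun k => (hp k).not).not.congr fun x => by simp

/-- Quantification is projection. Indexing by the sum `ι ⊕ κ` keeps free variables (`inl`) and bound
ones (`inr`) apart, so nested quantifiers give nested sums. -/
theorem exists_pi [Finite ι] [Finite κ] {q : (ι → ℝ) → (κ → ℝ) → Prop}
    (hq : D.DefinablePred fun z : ι ⊕ κ → ℝ => q (fun i => z (.inl i)) fun k => z (.inr k)) :
    D.DefinablePred fun x => ∃ y : κ → ℝ, q x y := by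
  obtain ⟨N, ⟨e⟩⟩ := Finite.exists_equiv_fin ι
  obtain ⟨K, ⟨e'⟩⟩ := Finite.exists_equiv_fin κ
  refine ⟨N, e.symm, _, D.exists_append_mem (m := K)
    (hq.comp (ι := Fin (N + K)) (Sum.elim (fun i => Fin.castAdd K (e i))
      fun k => Fin.natAdd N (e' k))).setOf_mem, fun x => ?_⟩
  simp only [Set.mem_ofPred_eq, Sum.elim_inl, Sum.elim_inr, Fin.append_left, Fin.append_right,
    Equiv.symm_apply_apply]
  constructor
  · rintro ⟨y, hy⟩
    exact ⟨fun i => y (e'.symm i), by simpa using hy⟩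
  · rintro ⟨y, hy⟩
    exact ⟨_, hy⟩

theorem forall_pi [Finite ι] [Finite κ] {q : (ι → ℝ) → (κ → ℝ) → Prop}
    (hq : D.DefinablePred fun z : ι ⊕ κ → ℝ => q (fun i => z (.inl i)) fun k => z (.inr k)) :
    D.DefinablePred fun x => ∀ y : κ → ℝ, q x y :=
  (exists_pi (q := fun x y => ¬ q x y) hq.not).not.congr fun x => by simp

theorem exists_real [Finite ι] {q : (ι → ℝ) → ℝ → Prop}
    (hq : D.DefinablePred fun z : ι ⊕ Unit → ℝ => q (fun i => z (.inl i)) (z (.inr ()))) :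
    D.DefinablePred fun x => ∃ t : ℝ, q x t :=
  (exists_pi (κ := Unit) (q := fun x y => q x (y ())) hq).congr fun _ =>
    ⟨fun ⟨t, ht⟩ => ⟨fun _ => t, ht⟩, fun ⟨_, hy⟩ => ⟨_, hy⟩⟩

theorem forall_real [Finite ι] {q : (ι → ℝ) → ℝ → Prop}
    (hq : D.DefinablePred fun z : ι ⊕ Unit → ℝ => q (fun i => z (.inl i)) (z (.inr ()))) :
    D.DefinablePred fun x => ∀ t : ℝ, q x t :=
  (exists_real (q := fun x y => ¬ q x y) hq.not).not.congr fun x => by simp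

theorem eq [Finite ι] (hu : IsPolynomialFun u) (hv : IsPolynomialFun v) :
    D.DefinablePred fun x => u x = v x := by
  obtain ⟨P, hP⟩ := hu.sub hv
  obtain ⟨N, ⟨e⟩⟩ := Finite.exists_equiv_fin ι
  refine ⟨N, e.symm, _, D.zeros_mem (MvPolynomial.rename e P), fun x => ?_⟩
  have : (fun i => x (e.symm i)) ∘ e = x := funext fun i => by simp
  simp only [Set.mem_ofPred_eq, MvPolynomial.eval_rename, this, ← hP, sub_eq_zero]

/-- The order is definable from the ring operations, since the nonnegative reals are the squares. -/
theorem le [Finite ι] (hu : IsPolynomialFun u) (hv : IsPolynomialFun v) :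
    D.DefinablePred fun x => u x ≤ v x := by
  have h : D.DefinablePred fun x => ∃ t : ℝ, v x - u x = t ^ 2 := by
    refine exists_real (q := fun x t => v x - u x = t ^ 2) (eq ?_ ((IsPolynomialFun.coord _).pow 2))
    obtain ⟨P, hP⟩ := hv.sub hu
    refine ⟨MvPolynomial.rename Sum.inl P, fun z => ?_⟩
    rw [hP, MvPolynomial.eval_rename]
    rfl
  refine h.congr fun x => ?_
  constructor
  · intro hx
    exact ⟨√(v x - u x), (Real.sq_sqrt (by linarith)).symm⟩
  · rintro ⟨t, ht⟩
    nlinarith [sq_nonneg t]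

theorem lt [Finite ι] (hu : IsPolynomialFun u) (hv : IsPolynomialFun v) :
    D.DefinablePred fun x => u x < v x :=
  (le hv hu).not.congr fun x => by simp

end DefinablePred

end OMinimalStructure

/-! ### Finite unions of intervals, and Baire category -/

open Filter Topology in
/-- A finite union of intervals that accumulates at `0` from the right contains some `(0, ε)`. -/
theorem exists_Ioo_subset_of_frequently {A : Set ℝ} {I : Set (Set ℝ)} (hI : I.Finite)
    (hJ : ∀ J ∈ I, J.OrdConnected) (hA : A = ⋃₀ I) (h : ∃ᶠ t in 𝓝[>] (0 : ℝ), t ∈ A) :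
    ∃ ε > 0, Set.Ioo 0 ε ⊆ A := by
  obtain ⟨J, hJI, hJf⟩ : ∃ J ∈ I, ∃ᶠ t in 𝓝[>] (0 : ℝ), t ∈ J := by
    by_contra! hcon
    refine h ?_
    have := (eventually_all_finite hI (p := fun J t => t ∉ J)).2
      hcon
    filter_upwards [this] with t ht htA
    rw [hA] at htA
    obtain ⟨J, hJ, htJ⟩ := htA
    exact ht J hJ htJ
  have key : ∀ δ > 0, ∃ t ∈ Set.Ioo 0 δ, t ∈ J := fun δ hδ => by
    obtain ⟨t, ht, htJ⟩ := (hJf.and_eventually (Ioo_mem_nhdsGT hδ)).exists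
    exact ⟨t, htJ, ht⟩
  obtain ⟨t₀, ht₀, ht₀J⟩ := key 1 one_pos
  refine ⟨t₀, ht₀.1, fun s hs => ?_⟩
  obtain ⟨t, ht, htJ⟩ := key s hs.1
  rw [hA]
  exact ⟨J, hJI, (hJ J hJI).out htJ ht₀J ⟨ht.2.le, hs.2.le⟩⟩

/-- If countably many sets, each a finite union of intervals, cover `ℝ`, then every nonempty open
set contains an open interval that lies in one of them. -/
theorem exists_Ioo_subset_of_countable_cover {κ : Type*} [Countable κ] {P : κ → Set ℝ}
    (hP : ∀ k, ∃ I : Set (Set ℝ), I.Finite ∧ (∀ J ∈ I, J.OrdConnected) ∧ P k = ⋃₀ I)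
    (hcov : ∀ t, ∃ k, t ∈ P k) {U : Set ℝ} (hU : IsOpen U) (hne : U.Nonempty) :
    ∃ p q, p < q ∧ Set.Ioo p q ⊆ U ∧ ∃ k, Set.Ioo p q ⊆ P k := by
  choose I hI hIJ hPI using hP
  obtain ⟨x, hx⟩ := hne
  obtain ⟨a, b, hxab, hab⟩ := mem_nhds_iff_exists_Ioo_subset.1 (hU.mem_nhds hx)
  -- Otherwise each of the countably many intervals meets `(a, b)` in at most one point, and
  -- together they cannot cover it.
  obtain ⟨k, J, hJ, hns⟩ : ∃ k, ∃ J ∈ I k, ¬ (J ∩ Set.Ioo a b).Subsingleton := by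
    by_contra! hcon
    have hc : (⋃ k, ⋃ J ∈ I k, J ∩ Set.Ioo a b).Countable :=
      Set.countable_iUnion fun k => (hI k).countable.biUnion fun J hJ =>
        (hcon k J hJ).countable
    obtain ⟨y, hy, hyab⟩ := (hc.dense_compl ℝ).exists_mem_open isOpen_Ioo ⟨x, hxab⟩
    obtain ⟨k, hk⟩ := hcov y
    rw [hPI k] at hk
    obtain ⟨J, hJ, hyJ⟩ := hk
    exact hy (Set.mem_iUnion.2 ⟨k, Set.mem_biUnion hJ ⟨hyJ, hyab⟩⟩)
  obtain ⟨p, hp, q, hq, hpq⟩ := (Set.not_subsingleton_iff.1 hns).exists_lt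
  refine ⟨p, q, hpq, fun t ht => hab ⟨hp.2.1.trans ht.1, ht.2.trans hq.2.2⟩, k, fun t ht => ?_⟩
  rw [hPI k]
  exact ⟨J, hJ, (hIJ k J hJ).out hp.1 hq.1 ⟨ht.1.le, ht.2.le⟩⟩

open Topology in
/-- A function on `ℝ` that on every nonempty open set has arbitrarily small oscillation on some
subinterval is continuous at the points of a dense set. -/
theorem dense_continuousAt_of_small_oscillation {E : Type*} [PseudoMetricSpace E] {g : ℝ → E}
    (h : ∀ ε > 0, ∀ U : Set ℝ, IsOpen U → U.Nonempty → ∃ p q, p < q ∧ Set.Ioo p q ⊆ U ∧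
      ∀ s ∈ Set.Ioo p q, ∀ t ∈ Set.Ioo p q, dist (g s) (g t) < ε) :
    Dense {t | ContinuousAt g t} := by
  set W : ℕ → Set ℝ := fun n => ⋃₀ {V | IsOpen V ∧
    ∀ s ∈ V, ∀ t ∈ V, dist (g s) (g t) < 1 / ((n : ℝ) + 1)} with hW
  -- Baire: each `W n` is open, and dense by the oscillation hypothesis.
  have hd : Dense (⋂ n, W n) := by
    refine dense_iInter_of_isOpen (fun n => isOpen_sUnion fun V hV => hV.1) fun n => ?_
    refine dense_iff_inter_open.2 fun U hU hne => ?_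
    obtain ⟨p, q, hpq, hsub, hosc⟩ := h (1 / ((n : ℝ) + 1)) (by positivity) U hU hne
    obtain ⟨t, ht⟩ := Set.nonempty_Ioo.2 hpq
    exact ⟨t, hsub ht, Set.Ioo p q, ⟨isOpen_Ioo, hosc⟩, ht⟩
  refine hd.mono fun t ht => Metric.continuousAt_iff'.2 fun ε hε => ?_
  obtain ⟨n, hn⟩ := exists_nat_one_div_lt hε
  obtain ⟨V, ⟨hV, hosc⟩, htV⟩ := Set.mem_iInter.1 ht n
  filter_upwards [hV.mem_nhds htV] with s hs
  exact (hosc s hs t htV).trans hn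

/-! ### Lexicographic minima -/

/-- The lexicographic order on `Fin d → ℝ`, in weak form. -/
def LexLE {d : ℕ} (y z : Fin d → ℝ) : Prop :=
  y = z ∨ ∃ i, (∀ j, j < i → y j = z j) ∧ y i < z i

theorem LexLE.antisymm {d : ℕ} {y z : Fin d → ℝ} (h : LexLE y z) (h' : LexLE z y) : y = z := by
  rcases h with h | ⟨i, hi, hlt⟩
  · exact h
  rcases h' with h' | ⟨j, hj, hlt'⟩
  · exact h'.symm
  rcases lt_trichotomy i j with hij | rfl | hij
  · exact absurd (hj i hij) hlt.ne'
  · exact absurd hlt hlt'.not_gt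
  · exact absurd (hi j hij) hlt'.ne'

/-- Minimize one coordinate at a time: the minimizers of a coordinate on a compact set form a
compact set, on which the next one is minimized. -/
theorem IsCompact.exists_lexLE {d : ℕ} {K : Set (Fin d → ℝ)} (hK : IsCompact K)
    (hne : K.Nonempty) : ∃ y ∈ K, ∀ z ∈ K, LexLE y z := by
  have key : ∀ k ≤ d, ∃ K' ⊆ K, IsCompact K' ∧ K'.Nonempty ∧ ∀ y ∈ K', ∀ z ∈ K,
      (z ∈ K' ∧ ∀ j : Fin d, j < k → y j = z j) ∨
        ∃ i, (∀ j, j < i → y j = z j) ∧ y i < z i := by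
    intro k
    induction k with
    | zero => exact fun _ => ⟨K, subset_rfl, hK, hne, fun y _ z hz => .inl ⟨hz, by simp⟩⟩
    | succ k ih =>
      intro hk
      obtain ⟨K', hsub, hc, hne', h⟩ := ih (by omega)
      obtain ⟨m, hm, hmin⟩ := hc.exists_isMinOn hne'
        (continuous_apply (⟨k, hk⟩ : Fin d)).continuousOn
      refine ⟨K' ∩ {y | y ⟨k, hk⟩ = m ⟨k, hk⟩}, Set.inter_subset_left.trans hsub,
        hc.inter_right (isClosed_eq (continuous_apply _) continuous_const), ⟨m, hm, rfl⟩, ?_⟩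
      rintro y ⟨hy, hym⟩ z hz
      rcases h y hy z hz with ⟨hzK, hyz⟩ | hlt
      · rcases (isMinOn_iff.1 hmin z hzK).eq_or_lt with he | hlt
        · refine .inl ⟨⟨hzK, he.symm⟩, fun j hj => ?_⟩
          rcases (Nat.lt_succ_iff.1 hj).eq_or_lt with hjk | hjk
          · obtain rfl : j = ⟨k, hk⟩ := Fin.ext hjk
            exact hym.trans he
          · exact hyz j hjk
        · exact .inr ⟨⟨k, hk⟩, fun j hj => hyz j hj, hym.trans_lt hlt⟩
      · exact .inr hlt
  obtain ⟨K', hsub, -, ⟨y, hy⟩, h⟩ := key d le_rfl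
  refine ⟨y, hsub hy, fun z hz => (h y hy z hz).imp (fun hyz => funext fun j => ?_) id⟩
  exact hyz.2 j j.2

/-! ### Definable selections and continuity of definable curves -/

namespace OMinimalStructure

variable {D : OMinimalStructure}

open DefinablePred in
theorem DefinablePred.lexLE {ι : Type*} [Finite ι] {d : ℕ} (σ τ : Fin d → ι) :
    D.DefinablePred fun x : ι → ℝ => LexLE (fun i => x (σ i)) fun i => x (τ i) := by
  have : D.DefinablePred fun x : ι → ℝ => (∀ i, x (σ i) = x (τ i)) ∨
      ∃ i, (∀ j, j < i → x (σ j) = x (τ j)) ∧ x (σ i) < x (τ i) :=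
    .or (forall_finite fun i => eq (.coord _) (.coord _)) (exists_finite fun i =>
      (forall_finite fun j => (const _).imp (eq (.coord _) (.coord _))).and
        (lt (.coord _) (.coord _)))
  exact this.congr fun x => by rw [LexLE, funext_iff]

/-- A definable subset of `ℝ`, given by a predicate, is a finite union of intervals. -/
theorem DefinablePred.exists_intervals {p : (Unit → ℝ) → Prop} (hp : D.DefinablePred p) :
    ∃ I : Set (Set ℝ), I.Finite ∧ (∀ J ∈ I, J.OrdConnected) ∧ {t : ℝ | p fun _ => t} = ⋃₀ I :=
  D.o_minimal (hp.comp fun _ => (0 : Fin 1)).setOf_mem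

/-- A curve `ℝ → ℝᵈ` with definable graph. -/
def DefinableGraph (D : OMinimalStructure) {d : ℕ} (g : ℝ → Fin d → ℝ) : Prop :=
  D.DefinablePred fun z : Unit ⊕ Fin d → ℝ => (fun i => z (.inr i)) = g (z (.inl ()))

/-- Compact nonempty definable families over `ℝ` have definable selections. -/
theorem exists_definable_selection {d : ℕ} {S : ℝ → (Fin d → ℝ) → Prop}
    (hS : D.DefinablePred fun z : Unit ⊕ Fin d → ℝ => S (z (.inl ())) fun i => z (.inr i))
    (hc : ∀ r, IsCompact {y | S r y}) (hne : ∀ r, ∃ y, S r y) :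
    ∃ g : ℝ → Fin d → ℝ, (∀ r, S r (g r)) ∧ D.DefinableGraph g := by
  choose g hg hmin using fun r => (hc r).exists_lexLE (hne r)
  refine ⟨g, hg, ?_⟩
  have hlex : D.DefinablePred fun z : Unit ⊕ Fin d → ℝ =>
      ∀ y, S (z (.inl ())) y → LexLE (fun i => z (.inr i)) y :=
    DefinablePred.forall_pi ((hS.comp (Sum.elim (fun _ => Sum.inl (Sum.inl ())) Sum.inr)).imp
      (DefinablePred.lexLE (fun i => Sum.inl (Sum.inr i)) Sum.inr))
  refine (hS.and hlex).congr fun z => ?_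
  constructor
  · intro h
    rw [h]
    exact ⟨hg _, hmin _⟩
  · rintro ⟨h, h'⟩
    exact (h' _ (hg _)).antisymm (hmin _ _ h)

namespace DefinableGraph

variable {d : ℕ} {g : ℝ → Fin d → ℝ}

open DefinablePred

theorem dense_continuousAt (hg : D.DefinableGraph g) : Dense {t | ContinuousAt g t} := by
  refine dense_continuousAt_of_small_oscillation fun ε hε U hU hne => ?_
  -- The times at which `g` lies in the `k`-th cube of a grid of side `ε / 2`. The value is named
  -- `y` because `g` enters formulas only through its graph.
  set P : (Fin d → ℤ) → Set ℝ := fun k => {t | ∃ y : Fin d → ℝ, y = g t ∧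
    ∀ i, (k i : ℝ) * (ε / 2) ≤ y i ∧ y i ≤ ((k i : ℝ) + 1) * (ε / 2)}
  have hP : ∀ k, ∃ I : Set (Set ℝ), I.Finite ∧ (∀ J ∈ I, J.OrdConnected) ∧ P k = ⋃₀ I :=
    fun k => exists_intervals (D := D)
      (p := fun x => ∃ y : Fin d → ℝ, y = g (x ()) ∧
        ∀ i, (k i : ℝ) * (ε / 2) ≤ y i ∧ y i ≤ ((k i : ℝ) + 1) * (ε / 2))
      (exists_pi (hg.and (forall_finite fun i => (le (.const _) (.coord _)).and
        (le (.coord _) (.const _)))))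
  have hcov : ∀ t, ∃ k, t ∈ P k := fun t =>
    ⟨fun i => ⌊g t i / (ε / 2)⌋, g t, rfl, fun i =>
      ⟨(le_div_iff₀ (half_pos hε)).1 (Int.floor_le _),
        (div_le_iff₀ (half_pos hε)).1 (Int.lt_floor_add_one _).le⟩⟩
  obtain ⟨p, q, hpq, hsub, k, hk⟩ := exists_Ioo_subset_of_countable_cover hP hcov hU hne
  refine ⟨p, q, hpq, hsub, fun s hs t ht => ?_⟩
  refine lt_of_le_of_lt ((dist_pi_le_iff (half_pos hε).le).2 fun i => ?_) (half_lt_self hε)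
  obtain ⟨_, rfl, hs⟩ := hk hs
  obtain ⟨_, rfl, ht⟩ := hk ht
  have := hs i
  have := ht i
  rw [Real.dist_eq, abs_le]
  constructor <;> linarith

/-- Spells continuity out as a formula built from quantifiers, polynomial inequalities and the graph
of `g`. -/
theorem continuousAt_iff :
    ∀ t, ContinuousAt g t ↔ ∀ ε : ℝ, 0 < ε → ∃ δ : ℝ, 0 < δ ∧ ∀ s : ℝ, s < t + δ → t < s + δ →
      ∀ y : Fin d → ℝ, y = g t → ∀ z : Fin d → ℝ, z = g s →
        ∀ i, z i ≤ y i + ε ∧ y i ≤ z i + ε := by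
  intro t
  have hle : ∀ s ε, 0 < ε → (dist (g s) (g t) ≤ ε ↔
      ∀ i, g s i ≤ g t i + ε ∧ g t i ≤ g s i + ε) := fun s ε hε => by
    rw [dist_pi_le_iff hε.le]
    refine forall_congr' fun i => ?_
    rw [Real.dist_eq, abs_le]
    constructor <;> rintro ⟨h, h'⟩ <;> constructor <;> linarith
  constructor
  · intro h ε hε
    obtain ⟨δ, hδ, h⟩ := Metric.continuousAt_iff.1 h ε hε
    refine ⟨δ, hδ, fun s hs hs' y hy z hz => ?_⟩
    subst hy hz
    refine (hle s ε hε).1 (h ?_).le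
    rw [Real.dist_eq, abs_lt]
    constructor <;> linarith
  · intro h
    refine Metric.continuousAt_iff.2 fun ε hε => ?_
    obtain ⟨δ, hδ, h⟩ := h (ε / 2) (half_pos hε)
    refine ⟨δ, hδ, fun {s} hs => ?_⟩
    rw [Real.dist_eq, abs_lt] at hs
    exact lt_of_le_of_lt ((hle s _ (half_pos hε)).2
      (h s (by linarith) (by linarith) _ rfl _ rfl)) (half_lt_self hε)

theorem definablePred_continuousAt (hg : D.DefinableGraph g) :
    D.DefinablePred fun x : Unit → ℝ => ContinuousAt g (x ()) := by
  refine DefinablePred.congr ?_ fun x => continuousAt_iff (x ())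
  refine forall_real (imp (lt (.const _) (.coord _)) (exists_real (and (lt (.const _) (.coord _))
    (forall_real (imp (lt (.coord _) (.add (.coord _) (.coord _)))
      (imp (lt (.coord _) (.add (.coord _) (.coord _))) (forall_pi (imp ?_
        (forall_pi (imp ?_ (forall_finite fun i =>
          (le (.coord _) (.add (.coord _) (.coord _))).and
            (le (.coord _) (.add (.coord _) (.coord _))))))))))))))
  -- The variables `ε`, `δ`, `s`, `y` have been bound after `t`, which puts `t` under four `inl`s.
  · exact hg.comp (Sum.elim (fun _ => Sum.inl (Sum.inl (Sum.inl (Sum.inl ())))) Sum.inr)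
  · exact hg.comp (Sum.elim (fun _ => Sum.inl (Sum.inl (Sum.inr ()))) Sum.inr)

open Filter Topology in
/-- A definable curve is continuous on some interval `(0, ε)`. -/
theorem exists_continuousAt (hg : D.DefinableGraph g) :
    ∃ ε > 0, ∀ t ∈ Set.Ioo 0 ε, ContinuousAt g t := by
  obtain ⟨I, hI, hJ, hA⟩ := hg.definablePred_continuousAt.exists_intervals
  refine exists_Ioo_subset_of_frequently hI hJ hA ?_
  intro hev
  -- Otherwise `g` is discontinuous throughout some `(0, u)`, against density.
  obtain ⟨u, hu, hsub⟩ := mem_nhdsGT_iff_exists_Ioo_subset.1 hev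
  obtain ⟨t, ht, htu⟩ := hg.dense_continuousAt.exists_mem_open isOpen_Ioo (Set.nonempty_Ioo.2 hu)
  exact hsub htu ht

end DefinableGraph

end OMinimalStructure

/-! ### Tangency points, and the passage from maximum to minimum -/

/-- Lagrange multipliers: minimizers on spheres about `c` are tangency points. -/
theorem mem_tangencySet_of_isMinOn_sphere {d : ℕ} {f : EuclideanSpace ℝ (Fin d) → ℝ}
    (hf : ContDiff ℝ 1 f) {c x : EuclideanSpace ℝ (Fin d)} (hx : x ≠ c)
    (hmin : ∀ y, ‖y - c‖ = ‖x - c‖ → f x ≤ f y) : x ∈ tangencySet f c := by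
  refine ⟨hx, ?_⟩
  have hfd : HasStrictFDerivAt f (fderiv ℝ f x) x := hf.contDiffAt.hasStrictFDerivAt one_ne_zero
  have hnd : HasStrictFDerivAt (fun y => ‖y - c‖ ^ 2) (2 • innerSL ℝ (x - c)) x := by
    simpa using (hasStrictFDerivAt_norm_sq (x - c)).comp x ((hasStrictFDerivAt_id x).sub_const c)
  have hext : IsLocalExtrOn f {y | ‖y - c‖ ^ 2 = ‖x - c‖ ^ 2} x :=
    .inl (IsMinOn.localize fun y hy => hmin y
      ((pow_left_inj₀ (norm_nonneg _) (norm_nonneg _) two_ne_zero).1 hy))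
  obtain ⟨a, b, hab, h⟩ := hext.exists_multipliers_of_hasStrictFDerivAt_1d hnd hfd
  have hxc : ‖x - c‖ ≠ 0 := norm_ne_zero_iff.2 (sub_ne_zero.2 hx)
  -- If `b = 0`, evaluating the relation at `x - c` gives `2 * a * ‖x - c‖ ^ 2 = 0`, so both
  -- multipliers vanish.
  have hb : b ≠ 0 := by
    rintro rfl
    have h' := DFunLike.congr_fun h (x - c)
    have ha : a = 0 := by
      simpa [hxc, sub_ne_zero.2 hx, -map_sub] using h'
    exact hab (by rw [ha]; rfl)
  refine ⟨-(2 * a / b), HasGradientAt.gradient ?_⟩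
  have heq : InnerProductSpace.toDual ℝ _ (-(2 * a / b) • (x - c)) = fderiv ℝ f x := by
    ext v
    have h' := DFunLike.congr_fun h v
    simp only [add_apply, smul_apply, smul_eq_mul, zero_apply, nsmul_eq_mul,
      innerSL_apply_apply, Nat.cast_ofNat] at h'
    rw [InnerProductSpace.toDual_apply_apply, real_inner_smul_left]
    field_simp
    linarith
  rw [hasGradientAt_iff_hasFDerivAt, heq]
  exact hfd.hasFDerivAt

theorem tangencySet_neg {d : ℕ} (f : EuclideanSpace ℝ (Fin d) → ℝ)
    (c : EuclideanSpace ℝ (Fin d)) : tangencySet (fun x => -f x) c ⊆ tangencySet f c := by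
  rintro x ⟨hx, μ, h⟩
  refine ⟨hx, -μ, ?_⟩
  have : gradient (fun x => -f x) x = -gradient f x := by
    simp [gradient, fderiv_fun_neg]
  rw [neg_smul, ← h, this, neg_neg]

theorem sphereMax_eq_neg_sphereMin_neg {d : ℕ} (f : EuclideanSpace ℝ (Fin d) → ℝ)
    (c : EuclideanSpace ℝ (Fin d)) (r : ℝ) :
    sphereMax f c r = -sphereMin (fun x => -f x) c r := by
  rw [sphereMax, sphereMin, Real.sInf_def, neg_neg, ← Set.image_neg_eq_neg, Set.image_image]
  simp

/-! ### The arc of minimizers -/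

namespace OMinimalStructure

variable {D : OMinimalStructure} {d : ℕ}

theorem DefinableFun.definablePred {f : EuclideanSpace ℝ (Fin d) → ℝ} (hf : D.DefinableFun f) :
    D.DefinablePred fun z : Fin d ⊕ Unit → ℝ =>
      f (WithLp.toLp 2 fun i => z (.inl i)) = z (.inr ()) := by
  refine ((DefinablePred.of_mem hf).comp (ι := Fin d ⊕ Unit)
    (Fin.append Sum.inl fun _ => Sum.inr ())).congr fun z => ?_
  constructor
  · intro h
    refine ⟨fun i => z (.inl i), trivial, funext fun k => ?_⟩
    refine Fin.addCases (fun i => ?_) (fun i => ?_) k <;> simp [h]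
  · rintro ⟨x, -, h⟩
    have h1 : (fun i => z (.inl i)) = x :=
      funext fun i => by simpa using congrFun h (Fin.castAdd 1 i)
    have h2 := congrFun h (Fin.natAdd d 0)
    simp only [Fin.append_right] at h2
    rw [h1, h2]

theorem DefinableGraph.definableCurve {g : ℝ → Fin d → ℝ} (hg : D.DefinableGraph g) (ε : ℝ) :
    D.DefinableCurve ε fun t => WithLp.toLp 2 (g t) := by
  have h : D.DefinablePred fun z : Fin (1 + d) → ℝ => (0 ≤ z (Fin.castAdd d 0) ∧
      z (Fin.castAdd d 0) < ε) ∧ (fun i => z (Fin.natAdd 1 i)) = g (z (Fin.castAdd d 0)) :=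
    ((DefinablePred.le (.const _) (.coord _)).and (DefinablePred.lt (.coord _) (.const _))).and
      (hg.comp (Sum.elim (fun _ => Fin.castAdd d 0) (Fin.natAdd 1)))
  refine Set.mem_of_eq_of_mem (Set.ext fun z => ?_) h.setOf_mem
  constructor
  · rintro ⟨x, hx, rfl⟩
    refine ⟨?_, ?_⟩
    · simpa using hx
    · ext i
      simp
  · rintro ⟨hz, hgz⟩
    refine ⟨fun _ => z (Fin.castAdd d 0), hz, funext fun k => ?_⟩
    refine Fin.addCases (fun i => ?_) (fun i => ?_) k
    · rw [Fin.append_left, Subsingleton.elim i 0]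
    · rw [Fin.append_right]
      exact congrFun hgz i

open DefinablePred in
/-- The relation between `r` and the minimizers of `f` on the sphere `∑ (yᵢ - cᵢ)² = r²`. -/
theorem definablePred_sphere_minimizer {f : EuclideanSpace ℝ (Fin d) → ℝ}
    (hf : D.DefinablePred fun z : Fin d ⊕ Unit → ℝ =>
      f (WithLp.toLp 2 fun i => z (.inl i)) = z (.inr ())) (c : EuclideanSpace ℝ (Fin d)) :
    D.DefinablePred fun z : Unit ⊕ Fin d → ℝ =>
      ∑ i, (z (.inr i) - c i) ^ 2 = z (.inl ()) ^ 2 ∧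
        ∀ y : Fin d → ℝ, ∑ i, (y i - c i) ^ 2 = z (.inl ()) ^ 2 →
          f (WithLp.toLp 2 fun i => z (.inr i)) ≤ f (WithLp.toLp 2 y) := by
  have hle : D.DefinablePred fun w : Fin d ⊕ Fin d → ℝ =>
      f (WithLp.toLp 2 fun i => w (.inl i)) ≤ f (WithLp.toLp 2 fun i => w (.inr i)) := by
    have : D.DefinablePred fun w : Fin d ⊕ Fin d → ℝ => ∃ s t : ℝ,
        f (WithLp.toLp 2 fun i => w (.inl i)) = s ∧ f (WithLp.toLp 2 fun i => w (.inr i)) = t ∧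
          s ≤ t :=
      exists_real (exists_real ((hf.comp (Sum.elim (fun i => Sum.inl (Sum.inl (Sum.inl i)))
        fun _ => Sum.inl (Sum.inr ()))).and ((hf.comp (Sum.elim (fun i => Sum.inl (Sum.inl (Sum.inr i)))
          fun _ => Sum.inr ())).and (le (.coord _) (.coord _)))))
    exact this.congr fun w => by simp
  have hs : D.DefinablePred fun z : Unit ⊕ Fin d → ℝ =>
      ∑ i, (z (.inr i) - c i) ^ 2 = z (.inl ()) ^ 2 :=
    eq (.sum fun i => ((IsPolynomialFun.coord _).sub (.const _)).pow 2)
      ((IsPolynomialFun.coord _).pow 2)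
  exact hs.and (forall_pi (imp
    (hs.comp (Sum.elim (fun _ => Sum.inl (Sum.inl ())) Sum.inr))
    (hle.comp (Sum.elim (fun i => Sum.inl (Sum.inr i)) Sum.inr))))

open Filter Topology in
theorem exists_tangencyArc_sphereMin (hd : 1 ≤ d) {f : EuclideanSpace ℝ (Fin d) → ℝ}
    (hf : ContDiff ℝ 1 f) (hfD : D.DefinablePred fun z : Fin d ⊕ Unit → ℝ =>
      f (WithLp.toLp 2 fun i => z (.inl i)) = z (.inr ()))
    (c : EuclideanSpace ℝ (Fin d)) :
    ∃ ε : ℝ, 0 < ε ∧ ∃ γ : ℝ → EuclideanSpace ℝ (Fin d),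
      IsTangencyArc f c ε γ ∧ IsArcLengthParam c ε γ ∧ D.DefinableCurve ε γ ∧
        ∀ r ∈ Set.Ico 0 ε, f (γ r) = sphereMin f c r := by
  -- The selection requires a nonempty compact fibre for every real `r`; the squared equation
  -- provides one for negative `r` too, on the sphere of radius `|r|`.
  have hsph : ∀ (y : Fin d → ℝ) (r : ℝ), ∑ i, (y i - c i) ^ 2 = r ^ 2 ↔
      WithLp.toLp 2 y ∈ Metric.sphere c |r| := fun y r => by
    rw [mem_sphere_iff_norm, ← pow_left_inj₀ (norm_nonneg _) (abs_nonneg r) two_ne_zero, sq_abs,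
      EuclideanSpace.real_norm_sq_eq]
    rfl
  have hiff : ∀ (y : Fin d → ℝ) (r : ℝ), (∑ i, (y i - c i) ^ 2 = r ^ 2 ∧
      ∀ z : Fin d → ℝ, ∑ i, (z i - c i) ^ 2 = r ^ 2 → f (WithLp.toLp 2 y) ≤ f (WithLp.toLp 2 z)) ↔
      WithLp.toLp 2 y ∈ Metric.sphere c |r| ∧ f (WithLp.toLp 2 y) = sphereMin f c |r| := by
    intro y r
    have hl := isLeast_sphereMin hd hf.continuous c (abs_nonneg r)
    simp only [hsph]
    refine and_congr_right fun hy => ⟨fun h => ?_, fun h z hz => ?_⟩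
    · have hl' : IsLeast (f '' Metric.sphere c |r|) (f (WithLp.toLp 2 y)) :=
        ⟨⟨_, hy, rfl⟩, by rintro _ ⟨z, hz, rfl⟩; exact h z.ofLp hz⟩
      exact hl'.unique hl
    · rw [h]
      exact hl.2 ⟨_, hz, rfl⟩
  have hc : ∀ r, IsCompact {y : Fin d → ℝ | ∑ i, (y i - c i) ^ 2 = r ^ 2 ∧ ∀ z : Fin d → ℝ,
      ∑ i, (z i - c i) ^ 2 = r ^ 2 → f (WithLp.toLp 2 y) ≤ f (WithLp.toLp 2 z)} := by
    intro r
    simp only [hiff]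
    have hK : IsCompact (Metric.sphere c |r| ∩ {x | f x = sphereMin f c |r|}) :=
      (isCompact_sphere c _).inter_right (isClosed_eq hf.continuous continuous_const)
    convert hK.image (PiLp.continuous_ofLp 2 fun _ : Fin d => ℝ) using 1
    ext y
    constructor
    · intro h
      exact ⟨_, h, rfl⟩
    · rintro ⟨x, h, rfl⟩
      exact h
  obtain ⟨g, hg, hgD⟩ := exists_definable_selection (definablePred_sphere_minimizer hfD c) hc
    fun r => by
      obtain ⟨x, hx, h⟩ := (isLeast_sphereMin hd hf.continuous c (abs_nonneg r)).1
      exact ⟨x.ofLp, (hiff _ _).2 ⟨hx, h⟩⟩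
  obtain ⟨ε, hε, hcont⟩ := hgD.exists_continuousAt
  have hmem : ∀ r, 0 ≤ r → ‖WithLp.toLp 2 (g r) - c‖ = r ∧
      f (WithLp.toLp 2 (g r)) = sphereMin f c r := fun r hr => by
    have := (hiff _ _).1 (hg r)
    rwa [mem_sphere_iff_norm, abs_of_nonneg hr] at this
  have h0 : WithLp.toLp 2 (g 0) = c := by simpa [sub_eq_zero] using (hmem 0 le_rfl).1
  refine ⟨ε, hε, fun t => WithLp.toLp 2 (g t), ⟨?_, h0, ?_⟩, fun t ht => (hmem t ht.1).1,
    hgD.definableCurve ε, fun r hr => (hmem r hr.1).2⟩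
  · intro t ht
    rcases ht.1.eq_or_lt with rfl | ht0
    -- At `0` the arc-length property alone gives continuity, with `δ = η`.
    · refine Metric.continuousWithinAt_iff.2 fun η hη => ⟨η, hη, fun {s} hs hsη => ?_⟩
      rw [h0, dist_eq_norm, (hmem s hs.1).1]
      exact (le_abs_self s).trans_lt (by simpa using hsη)
    · exact ((PiLp.continuous_toLp 2 _).continuousAt.comp
        (hcont t ⟨ht0, ht.2⟩)).continuousWithinAt
  · intro t ht
    refine mem_tangencySet_of_isMinOn_sphere hf (fun h => ?_) fun y hy => ?_
    · have := (hmem t ht.1.le).1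
      rw [h, sub_self, norm_zero] at this
      exact ht.1.ne this
    · rw [(hmem t ht.1.le).1] at hy
      rw [(hmem t ht.1.le).2]
      exact (isLeast_sphereMin hd hf.continuous c ht.1.le).2
        ⟨y, mem_sphere_iff_norm.2 hy, rfl⟩

end OMinimalStructure

theorem mainTheorem5 (D : OMinimalStructure) (d : ℕ) (hd : 1 ≤ d)
    (f : EuclideanSpace ℝ (Fin d) → ℝ) (hf : ContDiff ℝ 1 f) (hfD : D.DefinableFun f)
    (c : EuclideanSpace ℝ (Fin d)) :
    (∃ ε : ℝ, 0 < ε ∧ ∃ γ : ℝ → EuclideanSpace ℝ (Fin d),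
      IsTangencyArc f c ε γ ∧ IsArcLengthParam c ε γ ∧ D.DefinableCurve ε γ ∧
        ∀ r ∈ Set.Ico 0 ε, f (γ r) = sphereMin f c r) ∧
    (∃ ε : ℝ, 0 < ε ∧ ∃ γ : ℝ → EuclideanSpace ℝ (Fin d),
      IsTangencyArc f c ε γ ∧ IsArcLengthParam c ε γ ∧ D.DefinableCurve ε γ ∧
        ∀ r ∈ Set.Ico 0 ε, f (γ r) = sphereMax f c r) := by
  have hF := hfD.definablePred
  refine ⟨OMinimalStructure.exists_tangencyArc_sphereMin hd hf hF c, ?_⟩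
  have hF' : D.DefinablePred fun z : Fin d ⊕ Unit → ℝ =>
      -f (WithLp.toLp 2 fun i => z (.inl i)) = z (.inr ()) := by
    have : D.DefinablePred fun z : Fin d ⊕ Unit → ℝ => ∃ s : ℝ,
        f (WithLp.toLp 2 fun i => z (.inl i)) = s ∧ 0 - s = z (.inr ()) :=
      .exists_real ((hF.comp (Sum.elim (fun i => Sum.inl (Sum.inl i)) fun _ => Sum.inr ())).and
        (.eq (.sub (.const _) (.coord _)) (.coord _)))
    exact this.congr fun z => by simp
  obtain ⟨ε, hε, γ, hγ, harc, hdef, hmin⟩ :=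
    OMinimalStructure.exists_tangencyArc_sphereMin hd hf.neg hF' c
  refine ⟨ε, hε, γ, ⟨hγ.continuousOn, hγ.start,
    fun t ht => tangencySet_neg f c (hγ.mem_tangencySet t ht)⟩, harc, hdef, fun r hr => ?_⟩
  rw [sphereMax_eq_neg_sphereMin_neg, ← hmin r hr, neg_neg]
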